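/- **Setting (the BB84-INFO-$z$ protocol under a collective attack).** Let $n,n_z,n_x,r,m\ge 0$ be integers and $N=n+n_z+n_x$. For a bit string $s\in\mathbf F_2^t$, $|s|$ denotes the number of its $1$-bits, and $d_H(s,s')=|s+s'|$. Let $P_C$ be an $r\times n$ matrix with rows $v_1,\dots,v_r\in\mathbf F_2^n$ and $P_K$ an $m\times n$ matrix with rows $v_{r+1},\dots,v_{r+m}\in\mathbf F_2^n$, such that $v_1,\dots,v_{r+m}$ are linearly independent. Put $V_{r'}=\operatorname{Span}\{v_1,\dots,v_{r'}\}$ and $$d_{r,m}=\min_{r\le r'<r+m} d_H(v_{r'+1},V_{r'}).$$ A partition is a triple $\mathcal P=(s,z,b)$ of strings in $\mathbf F_2^N$ with $|s|=n$, $|z|=n_z$, $|b|=n_x$ and $|s+z+b|=N$; it splits the $N$ positions into INFO, TEST-Z and TEST-X positions. A subscript $s$, $z$ or $b$ on a string denotes its substring at the corresponding positions. Write $|i^0\rangle$ ($i\in\{0,1\}$) for the computational ($z$) basis of $\mathbb C^2$, $|0^1\rangle=(|0^0\rangle+|1^0\rangle)/\sqrt2$ and $|1^1\rangle=(|0^0\rangle-|1^0\rangle)/\sqrt2$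 for the $x$ basis. A collective attack consists, for each $1\le j\le N$, of a finite-dimensional probe space $E_j$, a unit vector $|0^E\rangle_{E_j}\in E_j$ and a unitary $U_j$ on $E_j\otimes\mathbb C^2$; it does not depend on $\mathcal P$ or on the bits sent. In the protocol, $\mathcal P$ and Alice's string $\mathbf i\in\mathbf F_2^N$ are uniform and independent; Alice sends $|i_1^{b_1}\rangle,\dots,|i_N^{b_N}\rangle$; Eve applies $U_j$ to $|0^E\rangle_{E_j}|i_j^{b_j}\rangle$ and keeps $E_j$; Bob measures the $j$-th qubit in the basis $b_j$ and obtains $i^B_j$. The error string is $\mathbf c=\mathbf i+\mathbf i^B$. For $\mathbf x\in\mathbf F_2^n$ let $\rho_{\mathbf x}^{\mathbf b'}$, $\mathbf b'=b_s$, be the state of Eve's probes attached to the INFO qubits, after the attack, if the INFO bits sent are $\mathbf x$. For a syndrome $\xi\in\mathbf F_2^r$ and a key $\mathbf k\in\mathbf F_2^m$ let $$\widehat\rho_{\mathbf k}=\frac1{2^{\,n-r-m}}\sum_{\mathbf x:\ \mathbf xP_C^{T}=\xi,\ \mathbf xP_K^{T}=\mathbf k}\rho_{\mathbf x}^{\mathbf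 b'} .$$ Finally let $\widetilde{\mathbf C}_I$ be the string of errors on the INFO bits in the virtual experiment that differs from the protocol only in that the INFO bits are encoded and measured in the $x$ basis (string of bases $b+s$ instead of $b$). **Proposition.** For every such $P_C,P_K$, every collective attack, every partition $\mathcal P$, all $\mathbf c_z\in\mathbf F_2^{n_z}$ and $\mathbf c_b\in\mathbf F_2^{n_x}$ such that the event that the partition is $\mathcal P$ and the error strings on the TEST-Z and TEST-X bits are $\mathbf c_z$ and $\mathbf c_b$ has positive probability, every $\xi\in\mathbf F_2^r$ and any two keys $\mathbf k,\mathbf k'\in\mathbf F_2^m$, $$\tfrac12\operatorname{tr}\left|\widehat\rho_{\mathbf k}-\widehat\rho_{\mathbf k'}\right|\ \le\ 2m\sqrt{P\left[\,|\widetilde{\mathbf C}_I|\ge \tfrac{d_{r,m}}2\ \middle|\ \mathbf c_z,\mathbf c_b,\mathcal P\right]} .$$ (For $m=0$, where $d_{r,m}$ is a minimum over the empty set, both sides are $0$.) -/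

import Mathlib

open scoped Matrix MatrixOrder Matrix.Norms.L2Operator

noncomputable section

namespace BB84InfoZ

/-! ### Bit strings -/

/-- Bit strings of length `t`, i.e. elements of `𝐅₂ᵗ`.  The number of `1`-bits is `hammingNorm`
and the Hamming distance is `hammingDist`. -/
abbrev Bits (t : ℕ) : Type := Fin t → ZMod 2

/-- The set of positions of the `1`-bits of `s`. -/
def ones {N : ℕ} (s : Bits N) : Finset (Fin N) := Finset.univ.filter fun j => s j ≠ 0

/-- The increasing enumeration of the positions of the `1`-bits of a string `s` with `|s| = t`. -/
def pos {N t : ℕ} (s : Bits N) (hs : hammingNorm s = t) : Fin t ↪o Fin N :=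
  (ones s).orderEmbOfFin hs

/-- The substring `i_s` of `i`, made of the bits of `i` at the positions where `s` is `1`. -/
def substring {N t : ℕ} (s : Bits N) (hs : hammingNorm s = t) (i : Bits N) : Bits t :=
  fun l => i (pos s hs l)

/-! ### The linear codes -/

/-- The vectors `v₁, …, v_{r+m}`: the rows of `P_C` followed by the rows of `P_K`.  The index is
shifted by one, so `rows PC PK i` is `v_{i+1}`. -/
def rows {n r m : ℕ} (PC : Matrix (Fin r) (Fin n) (ZMod 2))
    (PK : Matrix (Fin m) (Fin n) (ZMod 2)) : Fin (r + m) → Bits n :=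
  Fin.append (fun i => PC i) (fun i => PK i)

/-- Hamming distance from a vector to a subspace. -/
def distToSubspace {n : ℕ} (v : Bits n) (V : Submodule (ZMod 2) (Bits n)) : ℕ :=
  sInf {d | ∃ w ∈ V, d = hammingDist v w}

/-- `d_{r,m} = min_{r ≤ r' < r+m} d_H(v_{r'+1}, V_{r'})` with `V_{r'} = Span {v₁, …, v_{r'}}`. -/
def minDist {n r m : ℕ} (PC : Matrix (Fin r) (Fin n) (ZMod 2))
    (PK : Matrix (Fin m) (Fin n) (ZMod 2)) : ℕ :=
  sInf {d | ∃ r' : Fin (r + m), r ≤ (r' : ℕ) ∧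
    d = distToSubspace (rows PC PK r')
      (Submodule.span (ZMod 2) (rows PC PK '' {i | i < r'}))}

/-! ### Partitions of the transmitted bits -/

/-- Partitions `𝒫 = (s, z, b)` of the `N = n + n_z + n_x` bits: `|s| = n`, `|z| = n_z`,
`|b| = n_x` and `|s + z + b| = N`. -/
def Partition (n nz nx : ℕ) : Type :=
  {p : Bits (n + nz + nx) × Bits (n + nz + nx) × Bits (n + nz + nx) //
    hammingNorm p.1 = n ∧ hammingNorm p.2.1 = nz ∧ hammingNorm p.2.2 = nx ∧
      hammingNorm (p.1 + p.2.1 + p.2.2) = n + nz + nx}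

namespace Partition

variable {n nz nx : ℕ}

instance : Fintype (Partition n nz nx) := Subtype.fintype _

/-- The string marking the INFO bits. -/
def s (P : Partition n nz nx) : Bits (n + nz + nx) := P.1.1

/-- The string marking the TEST-Z bits. -/
def z (P : Partition n nz nx) : Bits (n + nz + nx) := P.1.2.1

/-- The string marking the TEST-X bits; it is also the string of bases used in the protocol
(`0` for the `z` basis, `1` for the `x` basis). -/
def b (P : Partition n nz nx) : Bits (n + nz + nx) := P.1.2.2

/-- The INFO substring of an `N`-bit string. -/
def info (P : Partition n nz nx) (i : Bits (n + nz + nx)) : Bits n :=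
  substring P.s P.2.1 i

/-- The TEST-Z substring of an `N`-bit string. -/
def testZ (P : Partition n nz nx) (i : Bits (n + nz + nx)) : Bits nz :=
  substring P.z P.2.2.1 i

/-- The TEST-X substring of an `N`-bit string. -/
def testX (P : Partition n nz nx) (i : Bits (n + nz + nx)) : Bits nx :=
  substring P.b P.2.2.2.1 i

/-- The position in the `N`-bit string of the `l`-th INFO bit. -/
def infoPos (P : Partition n nz nx) (l : Fin n) : Fin (n + nz + nx) := pos P.s P.2.1 l

/-- The string of bases in the virtual experiment in which the INFO bits are encoded (and
measured) in the `x` basis, everything else being as in the protocol. -/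
def conjBasis (P : Partition n nz nx) : Bits (n + nz + nx) := P.b + P.s

end Partition

/-! ### Qubits and the collective attack -/

/-- The qubit state `|i^c⟩`: bit `i` encoded in the `z` basis (`c = 0`) or the `x` basis
(`c = 1`), as a vector of coordinates in the computational basis. -/
def qubit (c i : ZMod 2) : ZMod 2 → ℂ :=
  if c = 0 then Pi.single i 1
  else fun t => (if i = 1 ∧ t = 1 then -1 else 1) / (Real.sqrt 2 : ℂ)

/-- A collective attack on `N` qubits: for every `j`, a probe space `ℂ^{dim j}`, an initial
(unit) probe state `|0^E⟩_{E_j}` and a unitary `U_j` on `ℂ^{dim j} ⊗ ℂ²`. -/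
structure CollectiveAttack (N : ℕ) where
  dim : Fin N → ℕ
  probe : ∀ j, Fin (dim j) → ℂ
  probe_normalized : ∀ j, ∑ a, ‖probe j a‖ ^ 2 = 1
  U : ∀ j, Matrix (Fin (dim j) × ZMod 2) (Fin (dim j) × ZMod 2) ℂ
  U_unitary : ∀ j, U j ∈ Matrix.unitaryGroup (Fin (dim j) × ZMod 2) ℂ

namespace CollectiveAttack

variable {N : ℕ} (A : CollectiveAttack N)

/-- The joint state `U_j |0^E⟩_{E_j} |i^c⟩_{T_j}` after the attack on the `j`-th qubit. -/
def joint (j : Fin N) (c i : ZMod 2) : Fin (A.dim j) × ZMod 2 → ℂ :=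
  A.U j *ᵥ fun p => A.probe j p.1 * qubit c i p.2

/-- The non-normalized probe state `|E^c_{i y}⟩ = ⟨y^c|_{T_j} U_j |0^E⟩_{E_j} |i^c⟩_{T_j}`. -/
def eveVec (j : Fin N) (c i y : ZMod 2) : Fin (A.dim j) → ℂ :=
  fun a => ∑ t, star (qubit c y t) * A.joint j c i (a, t)

/-- The probability that Bob measures the bit `y` on the `j`-th qubit, if Alice sent the bit `i`
and both used the basis `c`. -/
def bobProb (j : Fin N) (c i y : ZMod 2) : ℝ := ∑ a, ‖A.eveVec j c i y a‖ ^ 2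

/-- The state of Eve's `j`-th probe after the attack, if Alice sent `|i^c⟩`: the partial trace
over `T_j` of the joint state. -/
def eveState (j : Fin N) (c i : ZMod 2) : Matrix (Fin (A.dim j)) (Fin (A.dim j)) ℂ :=
  Matrix.of fun a a' => ∑ t, A.joint j c i (a, t) * star (A.joint j c i (a', t))

end CollectiveAttack

/-! ### Eve's states -/

section EveStates

variable {n nz nx r m : ℕ}

/-- Index set of the product basis of the space `⊗_{j ∈ I} E_j` of Eve's probes attached to the
INFO qubits. -/
abbrev ProbeIndex (A : CollectiveAttack (n + nz + nx)) (P : Partition n nz nx) : Type :=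
  ∀ l : Fin n, Fin (A.dim (P.infoPos l))

/-- Eve's state `ρ_x^{b'}` after the attack, if Alice sent the INFO string `x` in the bases `b'`:
the tensor product of the states of the probes attached to the INFO qubits. -/
def rhoInfo (A : CollectiveAttack (n + nz + nx)) (P : Partition n nz nx) (b' x : Bits n) :
    Matrix (ProbeIndex A P) (ProbeIndex A P) ℂ :=
  Matrix.of fun a a' => ∏ l, A.eveState (P.infoPos l) (b' l) (x l) (a l) (a' l)

/-- Eve's state `ρ̂_k` corresponding to the final key `k`, given the syndrome `ξ`:
the mixture of the states `ρ_x^{b'}` with `b' = b_s`, `x P_Cᵀ = ξ` and `x P_Kᵀ = k`. -/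
def rhoHat (A : CollectiveAttack (n + nz + nx)) (P : Partition n nz nx)
    (PC : Matrix (Fin r) (Fin n) (ZMod 2)) (PK : Matrix (Fin m) (Fin n) (ZMod 2))
    (ξ : Bits r) (k : Bits m) : Matrix (ProbeIndex A P) (ProbeIndex A P) ℂ :=
  ((2 : ℂ) ^ (n - r - m))⁻¹ •
    ∑ x : Bits n with x ᵥ* PCᵀ = ξ ∧ x ᵥ* PKᵀ = k, rhoInfo A P (P.info P.b) x

/-- `tr |M|`, where `|M| = √(Mᴴ M)`. -/
def trAbs {ι : Type*} [Fintype ι] [DecidableEq ι] (M : Matrix ι ι ℂ) : ℝ :=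
  (Matrix.trace (CFC.sqrt (Mᴴ * M))).re

end EveStates

/-! ### Probabilities -/

section Probability

variable {n nz nx : ℕ}

/-- Outcomes of an experiment: the partition `𝒫`, the string `i` sent by Alice and the string
`i^B` measured by Bob. -/
abbrev Outcome (n nz nx : ℕ) : Type :=
  Partition n nz nx × Bits (n + nz + nx) × Bits (n + nz + nx)

/-- The joint law of `(𝒫, i, i^B)` under the attack `A`, if Alice encodes and Bob measures in the
string of bases `basis 𝒫`: the partition `𝒫` and the string `i` are uniform and independent, and
the qubits are attacked and measured one by one. The protocol is the case
`basis = Partition.b`. -/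
def law (A : CollectiveAttack (n + nz + nx)) (basis : Partition n nz nx → Bits (n + nz + nx))
    (ω : Outcome n nz nx) : ℝ :=
  (Fintype.card (Partition n nz nx) : ℝ)⁻¹ * ((2 : ℝ) ^ (n + nz + nx))⁻¹ *
    ∏ j, A.bobProb j (basis ω.1 j) (ω.2.1 j) (ω.2.2 j)

open Classical in
/-- The probability of the event `E` under the weights `w`. -/
def prob {Ω : Type*} [Fintype Ω] (w : Ω → ℝ) (E : Set Ω) : ℝ := ∑ ω with ω ∈ E, w ω

/-- The conditional probability of `E` given `F` under the weights `w`
(meaningful if `F` has positive probability). -/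
def condProb {Ω : Type*} [Fintype Ω] (w : Ω → ℝ) (E F : Set Ω) : ℝ :=
  prob w (E ∩ F) / prob w F

/-- The error string `c = i + i^B`. -/
def errors (ω : Outcome n nz nx) : Bits (n + nz + nx) := ω.2.1 + ω.2.2

/-- The event that the partition is `P`, the errors on the TEST-Z bits are `cz` and the errors on
the TEST-X bits are `cb`. -/
def testEvent (P : Partition n nz nx) (cz : Bits nz) (cb : Bits nx) : Set (Outcome n nz nx) :=
  {ω | ω.1 = P ∧ ω.1.testZ (errors ω) = cz ∧ ω.1.testX (errors ω) = cb}

/-- The event that the number of errors on the INFO bits is at least `t`. -/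
def infoErrorEvent (t : ℝ) : Set (Outcome n nz nx) :=
  {ω | t ≤ (hammingNorm (ω.1.info (errors ω)) : ℝ)}

end Probability

end BB84InfoZ

end

/-!
Let `W` be the sign of the Hermitian matrix `ρ̂_k - ρ̂_k'`. Then `tr |ρ̂_k - ρ̂_k'|` is the
difference of `tr (W ρ̂_k)` and `tr (W ρ̂_k')`, so it suffices to compare `tr (W ρ̂_k)` with the
average of `tr (W ρ_x)` over all `x` with the syndrome `ξ`, which does not depend on `k`.

Purifying the probes, one gets pairwise orthogonal vectors `η_c`, one for each error string `c` of
the virtual experiment, such that `‖η_c‖²` is the probability of `c` and `ρ_x` is the reduced state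
of `φ_x = ∑_c (-1)^(x·c) η_c`. For a single qubit, `η_0` and `η_1` are half the sum and half the
difference of the vectors left by the bits `0` and `1`; an ancilla makes the inner product of these
two vectors real, hence `η_0` and `η_1` orthogonal, without changing any reduced state.

Fixing the `m` key bits one after the other, the step which adds the parity check `v_i` to the
earlier ones changes the average by the average of `(-1)^(x·v_i) ⟨φ_x, (W ⊗ 1) φ_x⟩` over the
current coset. The summand of the expansion with indices `c` and `c'` carries the sign
`(-1)^(x·(v_i + c + c'))`, so it averages to `0` unless `v_i + c + c'` lies in the span of the
earlier rows, and then `|c| + |c'| ≥ d_{r,m}`. Thus the part of `φ_x` with `|c| < d_{r,m} / 2`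
contributes nothing, and by Cauchy–Schwarz the rest costs at most
`2 √P[|C̃_I| ≥ d_{r,m} / 2]` per key bit.
-/

namespace BB84InfoZ

open scoped BigOperators ComplexConjugate InnerProductSpace Kronecker

/-! ### The trace norm -/

theorem exists_norm_le_one_trAbs_eq {ι : Type*} [Fintype ι] [DecidableEq ι] {D : Matrix ι ι ℂ}
    (hD : D.IsHermitian) : ∃ W : Matrix ι ι ℂ, ‖W‖ ≤ 1 ∧ trAbs D = (Matrix.trace (W * D)).re := by
  have hD' : IsSelfAdjoint D := hD
  let signD := cfc (fun x : ℝ => (SignType.sign x : ℝ)) D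
  have continuousOn (f : ℝ → ℝ) : ContinuousOn f (spectrum ℝ D) :=
    Matrix.finite_real_spectrum.continuousOn f
  have abs_eq : CFC.abs D = signD * D := by
    calc CFC.abs D = cfc (fun x : ℝ => (SignType.sign x : ℝ) * x) D := by
          simp only [CFC.abs_eq_cfc_norm D, Real.norm_eq_abs, sign_mul_self]
      _ = signD * D := by rw [cfc_mul _ _ D (continuousOn _) (continuousOn _), cfc_id' ℝ D]
  refine ⟨signD, norm_cfc_le zero_le_one fun x _ => ?_, by rw [← abs_eq]; rfl⟩
  rcases lt_trichotomy x 0 with h | h | h <;> simp [h]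

theorem norm_kronecker_one_le {ι κ : Type*} [Fintype ι] [DecidableEq ι] [Fintype κ]
    [DecidableEq κ] (W : Matrix ι ι ℂ) : ‖W ⊗ₖ (1 : Matrix κ κ ℂ)‖ ≤ ‖W‖ := by
  let kroneckerOne : Matrix ι ι ℂ →⋆ₙₐ[ℂ] Matrix (ι × κ) (ι × κ) ℂ :=
    { toFun := fun M => M ⊗ₖ (1 : Matrix κ κ ℂ)
      map_smul' := fun c M => by simp [Matrix.smul_kronecker]
      map_zero' := by simp
      map_add' := fun M N => by simp [Matrix.add_kronecker]
      map_mul' := fun M N => by rw [← Matrix.mul_kronecker_mul, one_mul]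
      map_star' := fun M => by simp [Matrix.star_eq_conjTranspose, Matrix.conjTranspose_kronecker] }
  exact NonUnitalStarAlgHom.norm_apply_le kroneckerOne W

/-! ### Reduced states and product vectors -/

section ReducedState

variable {𝕜 ι κ μ : Type*} [RCLike 𝕜] [Fintype κ] [Fintype μ]

/-- The reduced state on `𝕜^ι` of a vector of `𝕜^ι ⊗ 𝕜^κ`: the partial trace over `𝕜^κ` of
`|φ⟩⟨φ|`. -/
def reducedState (φ : EuclideanSpace 𝕜 (ι × κ)) : Matrix ι ι 𝕜 :=
  Matrix.of fun a a' => ∑ t, φ (a, t) * conj (φ (a', t))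

theorem isHermitian_reducedState (φ : EuclideanSpace 𝕜 (ι × κ)) :
    (reducedState φ).IsHermitian := by
  ext a a'
  simp [reducedState, mul_comm]

theorem trace_mul_reducedState [Fintype ι] [DecidableEq ι] [DecidableEq κ] (W : Matrix ι ι 𝕜)
    (φ : EuclideanSpace 𝕜 (ι × κ)) :
    (W * reducedState φ).trace =
      ⟪φ, Matrix.toEuclideanCLM (𝕜 := 𝕜) (W ⊗ₖ (1 : Matrix κ κ 𝕜)) φ⟫_𝕜 := by
  simp only [Matrix.trace, Matrix.diag, Matrix.mul_apply, reducedState, Matrix.of_apply,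
    PiLp.inner_apply, Matrix.ofLp_toEuclideanCLM, Matrix.mulVec, dotProduct,
    Fintype.sum_prod_type, Matrix.kroneckerMap_apply, Matrix.one_apply, RCLike.inner_apply,
    mul_ite, mul_one, mul_zero, ite_mul, zero_mul, Finset.sum_ite_eq, Finset.mem_univ, if_true,
    Finset.mul_sum, Finset.sum_mul]
  refine Finset.sum_congr rfl fun a _ => ?_
  rw [Finset.sum_comm]
  simp only [mul_assoc]

theorem trace_reducedState [Fintype ι] (φ : EuclideanSpace 𝕜 (ι × κ)) :
    (reducedState φ).trace = (‖φ‖ : 𝕜) ^ 2 := by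
  classical
  simpa using trace_mul_reducedState 1 φ

theorem norm_eq_of_reducedState_eq {κ' : Type*} [Fintype κ'] [Fintype ι]
    {φ : EuclideanSpace 𝕜 (ι × κ)} {φ' : EuclideanSpace 𝕜 (ι × κ')}
    (h : reducedState φ = reducedState φ') : ‖φ‖ = ‖φ'‖ := by
  have hsq : (‖φ‖ : 𝕜) ^ 2 = (‖φ'‖ : 𝕜) ^ 2 := by
    rw [← trace_reducedState, h, trace_reducedState]
  exact (sq_eq_sq₀ (norm_nonneg _) (norm_nonneg _)).1 (mod_cast hsq)

/-- The vector `φ ⊗ χ` of `𝕜^ι ⊗ (𝕜^κ ⊗ 𝕜^μ)`: the system with state `φ`, whose traced-out part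
`𝕜^κ` is enlarged by an ancilla in the state `χ`. -/
def attachAncilla (φ : EuclideanSpace 𝕜 (ι × κ)) (χ : EuclideanSpace 𝕜 μ) :
    EuclideanSpace 𝕜 (ι × κ × μ) :=
  WithLp.toLp 2 fun p => φ (p.1, p.2.1) * χ p.2.2

theorem inner_attachAncilla [Fintype ι] (φ φ' : EuclideanSpace 𝕜 (ι × κ))
    (χ χ' : EuclideanSpace 𝕜 μ) :
    ⟪attachAncilla φ χ, attachAncilla φ' χ'⟫_𝕜 = ⟪φ, φ'⟫_𝕜 * ⟪χ, χ'⟫_𝕜 := by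
  rw [PiLp.inner_apply, PiLp.inner_apply, PiLp.inner_apply, Finset.sum_mul_sum,
    Fintype.sum_prod_type, Fintype.sum_prod_type]
  refine Finset.sum_congr rfl fun a _ => ?_
  rw [Fintype.sum_prod_type]
  refine Finset.sum_congr rfl fun t _ => Finset.sum_congr rfl fun s _ => ?_
  simp only [attachAncilla, RCLike.inner_apply, map_mul, mul_mul_mul_comm]

theorem reducedState_attachAncilla (φ : EuclideanSpace 𝕜 (ι × κ)) {χ : EuclideanSpace 𝕜 μ}
    (hχ : ‖χ‖ = 1) : reducedState (attachAncilla φ χ) = reducedState φ := by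
  have sum_mul_conj : ∑ s, χ s * conj (χ s) = 1 := by
    simpa only [PiLp.inner_apply, RCLike.inner_apply, hχ, RCLike.ofReal_one, one_pow] using
      inner_self_eq_norm_sq_to_K (𝕜 := 𝕜) χ
  ext a a'
  refine (Fintype.sum_prod_type _).trans (Finset.sum_congr rfl fun t _ => ?_)
  rw [← mul_one (φ (a, t) * _), ← sum_mul_conj, Finset.mul_sum]
  refine Finset.sum_congr rfl fun s _ => ?_
  simp only [attachAncilla, map_mul, mul_mul_mul_comm]

end ReducedState

section TensorVec

variable {𝕜 L : Type*} [RCLike 𝕜] [Fintype L] {α β : L → Type*}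

/-- The product vector `⊗ₗ φₗ` of vectors `φₗ` of `𝕜^αₗ ⊗ 𝕜^βₗ`, the factors `𝕜^αₗ` being
gathered on the left and the factors `𝕜^βₗ` on the right. -/
def tensorVec (φ : ∀ l, EuclideanSpace 𝕜 (α l × β l)) :
    EuclideanSpace 𝕜 ((∀ l, α l) × (∀ l, β l)) :=
  WithLp.toLp 2 fun p => ∏ l, φ l (p.1 l, p.2 l)

theorem tensorVec_sum_smul [DecidableEq L] {γ : Type*} [Fintype γ] (k : L → γ → 𝕜)
    (η : ∀ l, γ → EuclideanSpace 𝕜 (α l × β l)) :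
    tensorVec (fun l => ∑ c, k l c • η l c) =
      ∑ c : L → γ, (∏ l, k l (c l)) • tensorVec fun l => η l (c l) := by
  ext p
  simp only [tensorVec, WithLp.ofLp_sum, WithLp.ofLp_smul, Finset.sum_apply, Pi.smul_apply,
    smul_eq_mul, Fintype.prod_sum, Finset.prod_mul_distrib]

variable [∀ l, Fintype (β l)] [DecidableEq L]

theorem inner_tensorVec [∀ l, Fintype (α l)] (φ ψ : ∀ l, EuclideanSpace 𝕜 (α l × β l)) :
    ⟪tensorVec φ, tensorVec ψ⟫_𝕜 = ∏ l, ⟪φ l, ψ l⟫_𝕜 := by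
  simp only [tensorVec, PiLp.inner_apply, RCLike.inner_apply, Fintype.sum_prod_type,
    Fintype.prod_sum, map_prod, Finset.prod_mul_distrib]

theorem reducedState_tensorVec (φ : ∀ l, EuclideanSpace 𝕜 (α l × β l)) :
    reducedState (tensorVec φ) = Matrix.of fun a a' => ∏ l, reducedState (φ l) (a l) (a' l) := by
  ext a a'
  simp only [reducedState, tensorVec, Matrix.of_apply, Fintype.prod_sum, map_prod,
    Finset.prod_mul_distrib]

end TensorVec

/-! ### Characters and cosets of codes -/

theorem exists_dotProduct_eq_of_notMem_span {F ι : Type*} [Field F] [Fintype ι]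
    {s : Set (ι → F)} {u : ι → F} (hu : u ∉ Submodule.span F s) (a : F) :
    ∃ y : ι → F, y ⬝ᵥ u = a ∧ ∀ w ∈ s, y ⬝ᵥ w = 0 := by
  classical
  obtain ⟨f, hfu, hf⟩ := Submodule.exists_le_ker_of_notMem hu
  obtain ⟨y, rfl⟩ := (dotProductEquiv F ι).surjective f
  refine ⟨(a / y ⬝ᵥ u) • y, ?_, fun w hw => ?_⟩
  · exact (smul_dotProduct _ _ _).trans (div_mul_cancel₀ a hfu)
  · rw [smul_dotProduct, show y ⬝ᵥ w = 0 from hf (Submodule.subset_span hw), smul_zero]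

section CodeCoset

variable {F ι κ : Type*} [Field F] [Fintype F] [DecidableEq F] [Fintype ι] [DecidableEq ι]

/-- The vectors with the prescribed syndrome `g` with respect to the parity checks `v j`, `j ∈ S`:
a coset of the linear code with these parity checks, if it is nonempty. -/
def codeCoset (v : κ → ι → F) (g : κ → F) (S : Finset κ) : Finset (ι → F) :=
  Finset.univ.filter fun x => ∀ j ∈ S, x ⬝ᵥ v j = g j

theorem mem_codeCoset {v : κ → ι → F} {g : κ → F} {S : Finset κ} {x : ι → F} :
    x ∈ codeCoset v g S ↔ ∀ j ∈ S, x ⬝ᵥ v j = g j := by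
  simp [codeCoset]

theorem codeCoset_insert [DecidableEq κ] (v : κ → ι → F) (g : κ → F) (S : Finset κ) (i : κ) :
    codeCoset v g (insert i S) = (codeCoset v g S).filter fun x => x ⬝ᵥ v i = g i := by
  ext x
  simp only [mem_codeCoset, Finset.mem_filter, Finset.forall_mem_insert, and_comm]

theorem sum_addChar_codeCoset_eq_zero {R : Type*} [CommRing R] [IsDomain R] {ψ : AddChar F R}
    (hψ : ψ ≠ 1) (v : κ → ι → F) (g : κ → F) {S : Finset κ} {u : ι → F}
    (hu : u ∉ Submodule.span F (v '' S)) : ∑ x ∈ codeCoset v g S, ψ (x ⬝ᵥ u) = 0 := by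
  obtain ⟨a, ha⟩ := AddChar.ne_one_iff.1 hψ
  obtain ⟨y, hyu, hyv⟩ := exists_dotProduct_eq_of_notMem_span hu a
  have sum_eq : ∑ x ∈ codeCoset v g S, ψ (x ⬝ᵥ u) = ψ a * ∑ x ∈ codeCoset v g S, ψ (x ⬝ᵥ u) := by
    rw [Finset.mul_sum]
    refine (Finset.sum_equiv (Equiv.addRight y) (fun x => ?_) fun x _ => ?_).symm
    · simp +contextual only [mem_codeCoset, Equiv.coe_addRight, add_dotProduct,
        fun j (hj : j ∈ S) => hyv (v j) ⟨j, hj, rfl⟩, add_zero]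
    · rw [Equiv.coe_addRight, add_dotProduct, hyu, AddChar.map_add_eq_mul, mul_comm]
  exact eq_zero_of_mul_eq_self_left ha sum_eq.symm

end CodeCoset

theorem zmod_two_eq_zero_or_eq_one (u : ZMod 2) : u = 0 ∨ u = 1 := by revert u; decide

theorem sum_zmod_two {M : Type*} [AddCommMonoid M] (f : ZMod 2 → M) : ∑ u, f u = f 0 + f 1 :=
  Fin.sum_univ_two f

/-- The nontrivial character `u ↦ (-1)ᵘ` of `𝐅₂`. -/
def sgn : AddChar (ZMod 2) ℂ := AddChar.zmodChar 2 (neg_one_sq : (-1 : ℂ) ^ 2 = 1)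

@[simp] theorem sgn_one : sgn 1 = -1 := by
  simp [sgn, AddChar.zmodChar_apply, ZMod.val_one]

theorem sgn_ne_one : sgn ≠ 1 :=
  AddChar.ne_one_iff.2 ⟨1, by rw [sgn_one]; norm_num⟩

@[simp] theorem sgn_mul_self (u : ZMod 2) : sgn u * sgn u = 1 := by
  rw [← AddChar.map_add_eq_mul, CharTwo.add_self_eq_zero, AddChar.map_zero_eq_one]

@[simp] theorem norm_sgn (u : ZMod 2) : ‖sgn u‖ = 1 := AddChar.norm_apply sgn u

@[simp] theorem conj_sgn (u : ZMod 2) : conj (sgn u) = sgn u := by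
  rw [← AddChar.map_neg_eq_conj, CharTwo.neg_eq]

theorem sgn_dotProduct {ι : Type*} [Fintype ι] (x c : ι → ZMod 2) :
    sgn (x ⬝ᵥ c) = ∏ l, sgn (x l * c l) :=
  map_prod sgn.toMonoidHom (fun l => Multiplicative.ofAdd (x l * c l)) Finset.univ

section BinaryCodeCoset

variable {ι κ : Type*} [Fintype ι] [DecidableEq ι]

theorem two_mul_sum_codeCoset_insert [DecidableEq κ] (v : κ → ι → ZMod 2)
    (g : κ → ZMod 2) (S : Finset κ) (i : κ)
    (f : (ι → ZMod 2) → ℂ) :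
    2 * ∑ x ∈ codeCoset v g (insert i S), f x =
      ∑ x ∈ codeCoset v g S, f x + sgn (g i) * ∑ x ∈ codeCoset v g S, sgn (x ⬝ᵥ v i) * f x := by
  have two_mul_indicator (s t : ZMod 2) :
      2 * (if s = t then (1 : ℂ) else 0) = 1 + sgn t * sgn s := by
    rcases zmod_two_eq_zero_or_eq_one s with rfl | rfl <;>
      rcases zmod_two_eq_zero_or_eq_one t with rfl | rfl <;> simp <;> norm_num
  rw [codeCoset_insert, Finset.sum_filter, Finset.mul_sum, Finset.mul_sum,
    ← Finset.sum_add_distrib]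
  refine Finset.sum_congr rfl fun x _ => ?_
  rw [← mul_boole, mul_left_comm, two_mul_indicator]
  ring

theorem two_mul_card_codeCoset_insert [DecidableEq κ] (v : κ → ι → ZMod 2)
    (g : κ → ZMod 2) {S : Finset κ} {i : κ}
    (hi : v i ∉ Submodule.span (ZMod 2) (v '' S)) :
    2 * (codeCoset v g (insert i S)).card = (codeCoset v g S).card := by
  have h := two_mul_sum_codeCoset_insert v g S i 1
  simp only [Pi.one_apply, mul_one, sum_addChar_codeCoset_eq_zero sgn_ne_one v g hi, mul_zero,
    add_zero, Finset.sum_const, nsmul_eq_mul] at h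
  exact_mod_cast h

theorem expect_codeCoset_insert [DecidableEq κ] (v : κ → ι → ZMod 2)
    (g : κ → ZMod 2) {S : Finset κ} {i : κ}
    (hi : v i ∉ Submodule.span (ZMod 2) (v '' S)) (f : (ι → ZMod 2) → ℂ) :
    𝔼 x ∈ codeCoset v g (insert i S), f x =
      𝔼 x ∈ codeCoset v g S, f x + sgn (g i) * 𝔼 x ∈ codeCoset v g S, sgn (x ⬝ᵥ v i) * f x := by
  have hcard : ((codeCoset v g S).card : ℂ) = 2 * (codeCoset v g (insert i S)).card :=
    mod_cast (two_mul_card_codeCoset_insert v g hi).symm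
  rw [Finset.expect_eq_sum_div_card, Finset.expect_eq_sum_div_card, Finset.expect_eq_sum_div_card,
    mul_div_assoc', ← add_div, ← two_mul_sum_codeCoset_insert, hcard,
    mul_div_mul_left _ _ two_ne_zero]

theorem card_codeCoset_mul {v : κ → ι → ZMod 2} (hv : LinearIndependent (ZMod 2) v)
    (g : κ → ZMod 2) (S : Finset κ) :
    (codeCoset v g S).card * 2 ^ S.card = 2 ^ Fintype.card ι := by
  classical
  induction S using Finset.induction_on with
  | empty => simp [codeCoset]
  | insert i S hi ih =>
    rw [Finset.card_insert_of_notMem hi, pow_succ', ← mul_assoc, mul_comm _ 2,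
      two_mul_card_codeCoset_insert v g (hv.notMem_span_image hi), ih]

theorem norm_expect_codeCoset_sub_le {r m : ℕ} {v : Fin (r + m) → ι → ZMod 2}
    (hv : LinearIndependent (ZMod 2) v) (g : Fin (r + m) → ZMod 2) (f : (ι → ZMod 2) → ℂ) {B : ℝ}
    (hB : ∀ i : Fin (r + m), r ≤ (i : ℕ) →
      ‖𝔼 x ∈ codeCoset v g (Finset.Iio i), sgn (x ⬝ᵥ v i) * f x‖ ≤ B) :
    ‖𝔼 x ∈ codeCoset v g Finset.univ, f x -
      𝔼 x ∈ codeCoset v g {j | (j : ℕ) < r}, f x‖ ≤ m * B := by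
  let initial (t : ℕ) : Finset (Fin (r + m)) := {j | (j : ℕ) < t}
  let avg (t : ℕ) : ℂ := 𝔼 x ∈ codeCoset v g (initial t), f x
  have dist_avg_succ_le {t : ℕ} (hrt : r ≤ t) (htm : t < r + m) :
      dist (avg t) (avg (t + 1)) ≤ B := by
    have initial_eq : initial t = Finset.Iio ⟨t, htm⟩ := by
      ext j; simp [initial, Fin.lt_def]
    have initial_succ : initial (t + 1) = insert ⟨t, htm⟩ (Finset.Iio ⟨t, htm⟩) := by
      ext j; simp [initial, Fin.le_def]
    have notMem_span := hv.notMem_span_image (s := (Finset.Iio (⟨t, htm⟩ : Fin (r + m)) : Set _))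
      (x := ⟨t, htm⟩) (by simp)
    simp only [avg, initial_succ, initial_eq, expect_codeCoset_insert v g notMem_span,
      dist_self_add_right, norm_mul, norm_sgn, one_mul]
    exact hB _ hrt
  have initial_all : initial (r + m) = Finset.univ := by simp [initial]
  have dist_le := dist_le_Ico_sum_of_dist_le (Nat.le_add_right r m) @dist_avg_succ_le
  rw [dist_comm, dist_eq_norm] at dist_le
  simpa [avg, initial_all] using dist_le

end BinaryCodeCoset

/-! ### The information-disturbance estimate -/

theorem norm_expect_le_of_le {α : Type*} {s : Finset α} {f : α → ℂ} {B : ℝ} (hB : 0 ≤ B)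
    (h : ∀ x ∈ s, ‖f x‖ ≤ B) : ‖𝔼 x ∈ s, f x‖ ≤ B := by
  rcases s.eq_empty_or_nonempty with rfl | hs
  · simpa using hB
  · exact (RCLike.norm_expect_le (K := ℂ)).trans (Finset.expect_le hs h)

section WalshSum

variable {ι E : Type*} [Fintype ι] [NormedAddCommGroup E]

/-- The superposition of the vectors `η c`, `c ∈ S`, with the signs of the character of `𝐅₂^ι`
attached to `x`. If `η c` is the state left by the error string `c` in the conjugate basis, the
sum over all strings `c` is the state left by the string `x` in the original basis. -/
def walshSum [NormedSpace ℂ E] (η : (ι → ZMod 2) → E) (S : Finset (ι → ZMod 2)) (x : ι → ZMod 2) :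
    E :=
  ∑ c ∈ S, sgn (x ⬝ᵥ c) • η c

theorem norm_inner_map_add_sub_le [InnerProductSpace ℂ E] (T : E →L[ℂ] E) (a b : E) :
    ‖⟪a + b, T (a + b)⟫_ℂ - ⟪b, T b⟫_ℂ‖ ≤ ‖T‖ * ‖a‖ * (‖a + b‖ + ‖b‖) := by
  have norm_inner_map_le (a b : E) : ‖⟪a, T b⟫_ℂ‖ ≤ ‖a‖ * (‖T‖ * ‖b‖) :=
    (norm_inner_le_norm _ _).trans (by gcongr; exact T.le_opNorm b)
  calc ‖⟪a + b, T (a + b)⟫_ℂ - ⟪b, T b⟫_ℂ‖ = ‖⟪a, T (a + b)⟫_ℂ + ⟪b, T a⟫_ℂ‖ := by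
        simp only [map_add, inner_add_left, inner_add_right]; ring_nf
    _ ≤ ‖a‖ * (‖T‖ * ‖a + b‖) + ‖b‖ * (‖T‖ * ‖a‖) :=
        norm_add_le_of_le (norm_inner_map_le _ _) (norm_inner_map_le _ _)
    _ = ‖T‖ * ‖a‖ * (‖a + b‖ + ‖b‖) := by ring

variable [InnerProductSpace ℂ E] {η : (ι → ZMod 2) → E}

theorem norm_walshSum (horth : Pairwise fun c c' => ⟪η c, η c'⟫_ℂ = 0)
    (S : Finset (ι → ZMod 2)) (x : ι → ZMod 2) :
    ‖walshSum η S x‖ = √(∑ c ∈ S, ‖η c‖ ^ 2) := by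
  have inner_self : ⟪walshSum η S x, walshSum η S x⟫_ℂ = ∑ c ∈ S, (‖η c‖ : ℂ) ^ 2 := by
    rw [walshSum, sum_inner]
    refine Finset.sum_congr rfl fun c hc => ?_
    rw [inner_sum, Finset.sum_eq_single_of_mem c hc fun c' _ hne => ?_]
    · rw [inner_smul_left, inner_smul_right, conj_sgn, ← mul_assoc, sgn_mul_self, one_mul,
        inner_self_eq_norm_sq_to_K]; rfl
    · rw [inner_smul_left, inner_smul_right, horth hne.symm, mul_zero, mul_zero]
  rw [norm_eq_sqrt_re_inner (𝕜 := ℂ), inner_self]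
  norm_cast

variable [DecidableEq ι] {κ : Type*}

theorem expect_codeCoset_sgn_inner_walshSum_eq_zero (v : κ → ι → ZMod 2) (g : κ → ZMod 2)
    {I : Finset κ} {u : ι → ZMod 2} {S : Finset (ι → ZMod 2)} (T : E →ₗ[ℂ] E)
    (hS : ∀ c ∈ S, ∀ c' ∈ S, u + c + c' ∉ Submodule.span (ZMod 2) (v '' I)) :
    𝔼 x ∈ codeCoset v g I, sgn (x ⬝ᵥ u) * ⟪walshSum η S x, T (walshSum η S x)⟫_ℂ = 0 := by
  have expand (x : ι → ZMod 2) : sgn (x ⬝ᵥ u) * ⟪walshSum η S x, T (walshSum η S x)⟫_ℂ =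
      ∑ c ∈ S, ∑ c' ∈ S, sgn (x ⬝ᵥ (u + c + c')) * ⟪η c, T (η c')⟫_ℂ := by
    simp only [walshSum, map_sum, map_smul, sum_inner, inner_sum, inner_smul_left,
      inner_smul_right, conj_sgn, Finset.mul_sum, dotProduct_add, AddChar.map_add_eq_mul]
    rw [Finset.sum_comm]
    refine Finset.sum_congr rfl fun c _ => Finset.sum_congr rfl fun c' _ => ?_
    ring
  rw [Finset.expect, Finset.sum_congr rfl fun x _ => expand x, Finset.sum_comm]
  refine smul_eq_zero_of_right _ (Finset.sum_eq_zero fun c hc => ?_)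
  rw [Finset.sum_comm]
  refine Finset.sum_eq_zero fun c' hc' => ?_
  rw [← Finset.sum_mul, sum_addChar_codeCoset_eq_zero sgn_ne_one v g (hS c hc c' hc'), zero_mul]

theorem norm_expect_sgn_inner_walshSum_le (horth : Pairwise fun c c' => ⟪η c, η c'⟫_ℂ = 0)
    (hone : ∑ c, ‖η c‖ ^ 2 = 1) (T : E →L[ℂ] E) (v : κ → ι → ZMod 2) (g : κ → ZMod 2)
    {I : Finset κ} {u : ι → ZMod 2} {H : Finset (ι → ZMod 2)}
    (hH : ∀ c ∉ H, ∀ c' ∉ H, u + c + c' ∉ Submodule.span (ZMod 2) (v '' I)) :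
    ‖𝔼 x ∈ codeCoset v g I,
        sgn (x ⬝ᵥ u) * ⟪walshSum η Finset.univ x, T (walshSum η Finset.univ x)⟫_ℂ‖ ≤
      2 * ‖T‖ * √(∑ c ∈ H, ‖η c‖ ^ 2) := by
  let φ := walshSum η Finset.univ
  let low := walshSum η Hᶜ
  have no_interference : 𝔼 x ∈ codeCoset v g I, sgn (x ⬝ᵥ u) * ⟪low x, T (low x)⟫_ℂ = 0 :=
    expect_codeCoset_sgn_inner_walshSum_eq_zero v g T.toLinearMap (by simpa using hH)
  have norm_φ (x) : ‖φ x‖ = 1 := by rw [norm_walshSum horth, hone, Real.sqrt_one]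
  have norm_low_le (x) : ‖low x‖ ≤ 1 := by
    rw [norm_walshSum horth, ← Real.sqrt_one, ← hone]
    exact Real.sqrt_le_sqrt (Finset.sum_le_univ_sum_of_nonneg fun _ => sq_nonneg _)
  have norm_sub_low_le (x) :
      ‖⟪φ x, T (φ x)⟫_ℂ - ⟪low x, T (low x)⟫_ℂ‖ ≤ 2 * ‖T‖ * √(∑ c ∈ H, ‖η c‖ ^ 2) := by
    have φ_eq : φ x = walshSum η H x + low x := (Finset.sum_add_sum_compl H _).symm
    calc ‖⟪φ x, T (φ x)⟫_ℂ - ⟪low x, T (low x)⟫_ℂ‖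
        ≤ ‖T‖ * ‖walshSum η H x‖ * (‖φ x‖ + ‖low x‖) := by
          rw [φ_eq]; exact norm_inner_map_add_sub_le T _ _
      _ ≤ ‖T‖ * √(∑ c ∈ H, ‖η c‖ ^ 2) * (1 + 1) := by
          rw [norm_walshSum horth H, norm_φ]; gcongr; exact norm_low_le x
      _ = 2 * ‖T‖ * √(∑ c ∈ H, ‖η c‖ ^ 2) := by ring
  calc ‖𝔼 x ∈ codeCoset v g I, sgn (x ⬝ᵥ u) * ⟪φ x, T (φ x)⟫_ℂ‖
      = ‖𝔼 x ∈ codeCoset v g I,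
          sgn (x ⬝ᵥ u) * (⟪φ x, T (φ x)⟫_ℂ - ⟪low x, T (low x)⟫_ℂ)‖ := by
        simp only [mul_sub, Finset.expect_sub_distrib, no_interference, sub_zero]
    _ ≤ 2 * ‖T‖ * √(∑ c ∈ H, ‖η c‖ ^ 2) := by
        refine norm_expect_le_of_le (by positivity) fun x _ => ?_
        rw [norm_mul, norm_sgn, one_mul]
        exact norm_sub_low_le x

end WalshSum

/-! ### A single qubit -/

section ErrorVec

variable {E : Type*} [NormedAddCommGroup E]

/-- The vector `η_c = (φ₀ + (-1)ᶜ φ₁) / 2` left by the error bit `c` in the conjugate basis, if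
`φ₀` and `φ₁` are the vectors left by the bits `0` and `1`. -/
noncomputable def errorVec [NormedSpace ℂ E] (φ : ZMod 2 → E) (c : ZMod 2) : E :=
  (2 : ℂ)⁻¹ • (φ 0 + sgn c • φ 1)

theorem sum_sgn_smul_errorVec [NormedSpace ℂ E] (φ : ZMod 2 → E) (i : ZMod 2) :
    ∑ c, sgn (i * c) • errorVec φ c = φ i := by
  rcases zmod_two_eq_zero_or_eq_one i with rfl | rfl <;>
    simp only [errorVec, sum_zmod_two, zero_mul, one_mul, AddChar.map_zero_eq_one, sgn_one] <;>
    module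

variable [InnerProductSpace ℂ E]

theorem norm_sq_errorVec (φ : ZMod 2 → E) (c : ZMod 2) :
    ‖errorVec φ c‖ ^ 2 =
      (‖φ 0‖ ^ 2 + 2 * ((sgn c).re * (⟪φ 0, φ 1⟫_ℂ).re) + ‖φ 1‖ ^ 2) / 4 := by
  have re_sgn_mul : (sgn c * ⟪φ 0, φ 1⟫_ℂ).re = (sgn c).re * (⟪φ 0, φ 1⟫_ℂ).re := by
    rcases zmod_two_eq_zero_or_eq_one c with rfl | rfl <;> simp
  rw [errorVec, norm_smul, mul_pow, norm_add_sq (𝕜 := ℂ), inner_smul_right, norm_smul, norm_sgn,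
    RCLike.re_eq_complex_re, re_sgn_mul]
  norm_num
  ring

theorem sum_norm_sq_errorVec (φ : ZMod 2 → E) :
    ∑ c, ‖errorVec φ c‖ ^ 2 = (‖φ 0‖ ^ 2 + ‖φ 1‖ ^ 2) / 2 := by
  simp only [sum_zmod_two, norm_sq_errorVec, AddChar.map_zero_eq_one, sgn_one, Complex.neg_re,
    Complex.one_re]
  ring

theorem pairwise_inner_errorVec_eq_zero {φ : ZMod 2 → E} (hnorm : ‖φ 0‖ = ‖φ 1‖)
    (hreal : ⟪φ 0, φ 1⟫_ℂ = (⟪φ 0, φ 1⟫_ℂ).re) :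
    Pairwise fun c c' => ⟪errorVec φ c, errorVec φ c'⟫_ℂ = 0 := by
  have inner_comm : ⟪φ 1, φ 0⟫_ℂ = ⟪φ 0, φ 1⟫_ℂ := by
    rw [← inner_conj_symm, hreal, Complex.conj_ofReal]
  have inner_zero_one : ⟪errorVec φ 0, errorVec φ 1⟫_ℂ = 0 := by
    simp only [errorVec, AddChar.map_zero_eq_one, sgn_one, inner_smul_left, inner_smul_right,
      inner_add_left, inner_add_right, inner_comm, inner_self_eq_norm_sq_to_K, hnorm, map_one]
    ring
  intro c c' hne
  rcases zmod_two_eq_zero_or_eq_one c with rfl | rfl <;>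
    rcases zmod_two_eq_zero_or_eq_one c' with rfl | rfl
  · exact absurd rfl hne
  · exact inner_zero_one
  · exact inner_eq_zero_symm.1 inner_zero_one
  · exact absurd rfl hne

end ErrorVec

section Purification

variable {ι κ : Type*} [Fintype ι] [Fintype κ]

theorem exists_norm_eq_one_mul_eq_re (z : ℂ) :
    ∃ χ : EuclideanSpace ℂ (Fin 2), ‖χ‖ = 1 ∧ z * χ 0 = z.re := by
  obtain ⟨w, hzw, hw⟩ : ∃ w : ℂ, z * w = z.re ∧ ‖w‖ ≤ 1 := by
    rcases eq_or_ne z 0 with rfl | hz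
    · exact ⟨0, by simp⟩
    · refine ⟨z.re / z, mul_div_cancel₀ _ hz, ?_⟩
      rw [norm_div, Complex.norm_real]
      exact div_le_one_of_le₀ (Complex.abs_re_le_norm z) (norm_nonneg _)
  have hw_sq : 0 ≤ 1 - ‖w‖ ^ 2 := sub_nonneg.2 (pow_le_one₀ (norm_nonneg _) hw)
  refine ⟨!₂[w, (√(1 - ‖w‖ ^ 2) : ℝ)], ?_, hzw⟩
  simp [EuclideanSpace.norm_eq, Fin.sum_univ_two, Real.sq_sqrt hw_sq]

theorem exists_reducedState_eq_inner_eq_re (φ : ZMod 2 → EuclideanSpace ℂ (ι × κ)) :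
    ∃ φ' : ZMod 2 → EuclideanSpace ℂ (ι × κ × Fin 2),
      (∀ i, reducedState (φ' i) = reducedState (φ i)) ∧ ⟪φ' 0, φ' 1⟫_ℂ = (⟪φ 0, φ 1⟫_ℂ).re := by
  obtain ⟨χ, norm_χ, hχ⟩ := exists_norm_eq_one_mul_eq_re ⟪φ 0, φ 1⟫_ℂ
  let e : EuclideanSpace ℂ (Fin 2) := EuclideanSpace.single 0 1
  refine ⟨fun i => attachAncilla (φ i) (if i = 0 then e else χ), fun i => ?_, ?_⟩
  · refine reducedState_attachAncilla _ ?_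
    split_ifs
    · simp [e]
    · exact norm_χ
  · simp [inner_attachAncilla, e, hχ, EuclideanSpace.inner_single_left]

theorem exists_errorVec_purification {φ : ZMod 2 → EuclideanSpace ℂ (ι × κ)}
    (hφ : ‖φ 0‖ = ‖φ 1‖) :
    ∃ η : ZMod 2 → EuclideanSpace ℂ (ι × κ × Fin 2),
      (∀ i, reducedState (∑ c, sgn (i * c) • η c) = reducedState (φ i)) ∧
      (Pairwise fun c c' => ⟪η c, η c'⟫_ℂ = 0) ∧ ∀ c, ‖η c‖ = ‖errorVec φ c‖ := by
  obtain ⟨φ', reduced_eq, inner_eq⟩ := exists_reducedState_eq_inner_eq_re φ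
  have norm_eq (i) : ‖φ' i‖ = ‖φ i‖ := norm_eq_of_reducedState_eq (reduced_eq i)
  refine ⟨errorVec φ', fun i => ?_, pairwise_inner_errorVec_eq_zero ?_ ?_, fun c => ?_⟩
  · rw [sum_sgn_smul_errorVec, reduced_eq]
  · rw [norm_eq, norm_eq, hφ]
  · rw [inner_eq, Complex.ofReal_re]
  · rw [← sq_eq_sq₀ (norm_nonneg _) (norm_nonneg _), norm_sq_errorVec, norm_sq_errorVec, norm_eq,
      norm_eq, inner_eq, Complex.ofReal_re]

end Purification

/-! ### The attack on one qubit -/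

theorem qubit_zero (i : ZMod 2) : qubit 0 i = Pi.single i 1 :=
  if_pos rfl

theorem qubit_one_apply (i t : ZMod 2) : qubit 1 i t = sgn (i * t) / (√2 : ℝ) := by
  rcases zmod_two_eq_zero_or_eq_one i with rfl | rfl <;>
    rcases zmod_two_eq_zero_or_eq_one t with rfl | rfl <;> simp [qubit]

namespace CollectiveAttack

variable {N : ℕ} (A : CollectiveAttack N)

/-- The probability of the error bit `c` on the `j`-th qubit if it is sent and measured in the
basis `d`, the bit sent being uniform. -/
noncomputable def errProb (j : Fin N) (d c : ZMod 2) : ℝ := (∑ i, A.bobProb j d i (i + c)) / 2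

/-- The joint state after the attack on the bit `i` in the `z` basis, in which Bob's qubit is
replaced by the error bit (the measured bit plus `i`). -/
noncomputable def alignedJoint (j : Fin N) (i : ZMod 2) :
    EuclideanSpace ℂ (Fin (A.dim j) × ZMod 2) :=
  WithLp.toLp 2 fun p => A.joint j 0 i (p.1, p.2 + i)

theorem norm_joint_zero (j : Fin N) (i : ZMod 2) : ‖WithLp.toLp 2 (A.joint j 0 i)‖ = 1 := by
  let initial : EuclideanSpace ℂ (Fin (A.dim j) × ZMod 2) :=
    WithLp.toLp 2 fun p => A.probe j p.1 * qubit 0 i p.2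
  have norm_initial : ‖initial‖ = 1 := by
    simp [initial, EuclideanSpace.norm_eq, Fintype.sum_prod_type, qubit_zero, Pi.single_apply,
      apply_ite, A.probe_normalized]
  have hU : Matrix.toEuclideanCLM (𝕜 := ℂ) (A.U j) ∈ unitary _ := Unitary.map_mem _ (A.U_unitary j)
  rw [joint, ← Matrix.toEuclideanCLM_toLp, ← norm_initial]
  exact ContinuousLinearMap.norm_map_of_mem_unitary hU initial

theorem reducedState_alignedJoint (j : Fin N) (i : ZMod 2) :
    reducedState (A.alignedJoint j i) = A.eveState j 0 i := by
  ext a a'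
  exact Equiv.sum_comp (Equiv.addRight i)
    fun t => A.joint j 0 i (a, t) * star (A.joint j 0 i (a', t))

theorem norm_alignedJoint (j : Fin N) (i : ZMod 2) : ‖A.alignedJoint j i‖ = 1 := by
  rw [← A.norm_joint_zero j i]
  exact norm_eq_of_reducedState_eq (A.reducedState_alignedJoint j i)

theorem joint_one (j : Fin N) (i : ZMod 2) :
    A.joint j 1 i = ((√2 : ℝ) : ℂ)⁻¹ • (A.joint j 0 0 + sgn i • A.joint j 0 1) := by
  rw [joint, joint, joint, ← Matrix.mulVec_smul, ← Matrix.mulVec_add, ← Matrix.mulVec_smul]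
  congr 1
  ext ⟨a, t⟩
  rcases zmod_two_eq_zero_or_eq_one t with rfl | rfl <;>
    rcases zmod_two_eq_zero_or_eq_one i with rfl | rfl <;>
    simp [qubit_one_apply, qubit_zero, div_eq_inv_mul, mul_comm]

theorem eveVec_one (j : Fin N) (i c : ZMod 2) (a : Fin (A.dim j)) :
    A.eveVec j 1 i (i + c) a =
      errorVec (A.alignedJoint j) c (a, 0) +
        sgn (i + c) * errorVec (A.alignedJoint j) c (a, 1) := by
  have sqrt_two_sq : ((√2 : ℝ) : ℂ) ^ 2 = 2 := by norm_cast; simp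
  simp only [eveVec, errorVec, alignedJoint, sum_zmod_two, qubit_one_apply, joint_one, star_div₀,
    RCLike.star_def, conj_sgn, Complex.conj_ofReal, PiLp.add_apply, PiLp.smul_apply, Pi.add_apply,
    Pi.smul_apply, smul_eq_mul, mul_zero, mul_one, add_zero, zero_add, CharTwo.add_self_eq_zero,
    AddChar.map_zero_eq_one, AddChar.map_add_eq_mul]
  field_simp
  rw [sqrt_two_sq]
  linear_combination 2 * sgn c * A.joint j 0 1 (a, 1) * sgn_mul_self i -
    2 * sgn i * A.joint j 0 1 (a, 0) * sgn_mul_self c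

theorem errProb_one (j : Fin N) (c : ZMod 2) :
    A.errProb j 1 c = ‖errorVec (A.alignedJoint j) c‖ ^ 2 := by
  have parallelogram (x y : ℂ) :
      ∑ i : ZMod 2, ‖x + sgn (i + c) * y‖ ^ 2 = 2 * (‖x‖ ^ 2 + ‖y‖ ^ 2) := by
    refine (Equiv.sum_comp (Equiv.addRight c) fun i => ‖x + sgn i * y‖ ^ 2).trans ?_
    simpa [sum_zmod_two, sq, sub_eq_add_neg] using parallelogram_law_with_norm ℂ x y
  simp only [errProb, bobProb, eveVec_one]
  rw [Finset.sum_comm, EuclideanSpace.norm_sq_eq, Fintype.sum_prod_type, Finset.sum_div]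
  refine Finset.sum_congr rfl fun a _ => ?_
  rw [parallelogram, mul_div_cancel_left₀ _ two_ne_zero, sum_zmod_two]

theorem sum_errProb_one (j : Fin N) : ∑ c, A.errProb j 1 c = 1 := by
  simp only [errProb_one, sum_norm_sq_errorVec, norm_alignedJoint]
  norm_num

end CollectiveAttack

/-! ### The attack on the INFO qubits -/

variable {n nz nx : ℕ}

section InfoQubits

variable (A : CollectiveAttack (n + nz + nx)) (P : Partition n nz nx)

theorem isHermitian_rhoInfo (b' x : Bits n) : (rhoInfo A P b' x).IsHermitian := by
  have isHermitian_eveState (j) (d i) : (A.eveState j d i).IsHermitian :=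
    isHermitian_reducedState (WithLp.toLp 2 (A.joint j d i))
  ext a a'
  simp only [rhoInfo, Matrix.conjTranspose_apply, Matrix.of_apply, star_prod,
    (isHermitian_eveState _ _ _).apply]

theorem exists_infoErrorVec :
    ∃ η : Bits n → EuclideanSpace ℂ (ProbeIndex A P × (Fin n → ZMod 2 × Fin 2)),
      (∀ x, reducedState (walshSum η Finset.univ x) = rhoInfo A P 0 x) ∧
      (Pairwise fun c c' => ⟪η c, η c'⟫_ℂ = 0) ∧
      ∀ c, ‖η c‖ ^ 2 = ∏ l, A.errProb (P.infoPos l) 1 (c l) := by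
  have norm_eq (l) : ‖A.alignedJoint (P.infoPos l) 0‖ = ‖A.alignedJoint (P.infoPos l) 1‖ := by
    simp only [A.norm_alignedJoint]
  choose η reduced_eq horth hnorm using fun l => exists_errorVec_purification (norm_eq l)
  refine ⟨fun c => tensorVec fun l => η l (c l), fun x => ?_, fun c c' hne => ?_, fun c => ?_⟩
  · simp only [walshSum, sgn_dotProduct]
    rw [← tensorVec_sum_smul (fun l c => sgn (x l * c)) η, reducedState_tensorVec]
    simp only [reduced_eq, A.reducedState_alignedJoint]
    rfl
  · obtain ⟨l, hl⟩ := Function.ne_iff.1 hne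
    rw [inner_tensorVec]
    exact Finset.prod_eq_zero (Finset.mem_univ l) (horth l hl)
  · rw [norm_sq_eq_re_inner (𝕜 := ℂ), inner_tensorVec]
    simp only [inner_self_eq_norm_sq_to_K, hnorm, A.errProb_one]
    norm_cast

end InfoQubits

/-! ### The positions of a partition -/

theorem pos_mem_ones {N t : ℕ} (s : Bits N) (hs : hammingNorm s = t) (l : Fin t) :
    pos s hs l ∈ ones s :=
  Finset.orderEmbOfFin_mem _ _ _

theorem eq_one_of_mem_ones {N : ℕ} {s : Bits N} {j : Fin N} (hj : j ∈ ones s) : s j = 1 :=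
  (zmod_two_eq_zero_or_eq_one _).resolve_left (Finset.mem_filter.1 hj).2

theorem eq_zero_of_notMem_ones {N : ℕ} {s : Bits N} {j : Fin N} (hj : j ∉ ones s) : s j = 0 := by
  simpa [ones] using hj

namespace Partition

variable (P : Partition n nz nx)

theorem disjoint_ones_s : Disjoint (ones P.s) (ones P.z ∪ ones P.b) := by
  have card_s : (ones P.s).card = n := P.2.1
  have card_z : (ones P.z).card = nz := P.2.2.1
  have card_b : (ones P.b).card = nx := P.2.2.2.1
  have card_add : (ones (P.s + P.z + P.b)).card = n + nz + nx := P.2.2.2.2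
  have ones_add_subset : ones (P.s + P.z + P.b) ⊆ ones P.s ∪ (ones P.z ∪ ones P.b) := by
    intro j hj
    by_contra hj'
    simp_all [ones]
  have card_zb_le := Finset.card_union_le (ones P.z) (ones P.b)
  have card_union_le := Finset.card_union_le (ones P.s) (ones P.z ∪ ones P.b)
  have card_le := Finset.card_le_card ones_add_subset
  exact Finset.card_union_eq_card_add_card.1 (by omega)

theorem infoPos_notMem (l : Fin n) : P.infoPos l ∉ ones P.z ∪ ones P.b :=
  Finset.disjoint_left.1 P.disjoint_ones_s (pos_mem_ones _ _ l)

theorem b_infoPos (l : Fin n) : P.b (P.infoPos l) = 0 :=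
  eq_zero_of_notMem_ones fun h => P.infoPos_notMem l (Finset.mem_union_right _ h)

theorem info_b : P.info P.b = 0 :=
  funext P.b_infoPos

theorem conjBasis_infoPos (l : Fin n) : P.conjBasis (P.infoPos l) = 1 := by
  rw [conjBasis, Pi.add_apply, P.b_infoPos, zero_add]
  exact eq_one_of_mem_ones (pos_mem_ones _ _ l)

theorem infoPos_injective : Function.Injective P.infoPos :=
  (pos P.s P.2.1).injective

theorem dependsOn_testZ : DependsOn P.testZ (Set.range P.infoPos)ᶜ := by
  refine fun c c' h => funext fun l => h _ ?_
  rintro ⟨l', hl'⟩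
  exact P.infoPos_notMem l' (hl' ▸ Finset.mem_union_left _ (pos_mem_ones _ _ l))

theorem dependsOn_testX : DependsOn P.testX (Set.range P.infoPos)ᶜ := by
  refine fun c c' h => funext fun l => h _ ?_
  rintro ⟨l', hl'⟩
  exact P.infoPos_notMem l' (hl' ▸ Finset.mem_union_right _ (pos_mem_ones _ _ l))

end Partition

/-! ### The law of the errors -/

section Independence

variable {ι κ α : Type*} [Fintype ι] [Fintype κ] [Fintype α] [DecidableEq ι] [DecidableEq κ]

theorem prob_prod_eq_mul {e : κ → ι} (he : Function.Injective e) (q : ι → α → ℝ)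
    (E : Set (κ → α)) (F : Set (↥(Set.range e)ᶜ → α)) :
    prob (fun c : ι → α => ∏ j, q j (c j))
        {c | c ∘ e ∈ E ∧ Set.domRestrict (Set.range e)ᶜ c ∈ F} =
      prob (fun d => ∏ l, q (e l) (d l)) E *
        prob (fun d => ∏ j : ↥(Set.range e)ᶜ, q j (d j)) F := by
  classical
  let split : κ ⊕ ↥(Set.range e)ᶜ ≃ ι :=
    ((Equiv.ofInjective e he).sumCongr (Equiv.refl _)).trans (Equiv.sumCompl (· ∈ Set.range e))
  let splitString : (ι → α) ≃ (κ → α) × (↥(Set.range e)ᶜ → α) :=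
    (split.arrowCongr (Equiv.refl α)).symm.trans (Equiv.sumArrowEquivProdArrow _ _ _)
  have splitString_apply (c : ι → α) : splitString c = (c ∘ e, Set.domRestrict (Set.range e)ᶜ c) :=
    rfl
  rw [prob, prob, prob, Finset.sum_mul_sum, ← Finset.sum_product']
  refine Finset.sum_equiv splitString (fun c => ?_) fun c _ => ?_
  · simp [splitString_apply]
  · rw [← split.prod_comp, Fintype.prod_sum_type]
    rfl

theorem prob_prod_inter_of_dependsOn {e : κ → ι} (he : Function.Injective e) {q : ι → α → ℝ}
    (hq : ∀ l, ∑ a, q (e l) a = 1) (E : Set (κ → α)) {F : Set (ι → α)}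
    (hF : DependsOn (· ∈ F) (Set.range e)ᶜ) :
    prob (fun c => ∏ j, q j (c j)) ({c | c ∘ e ∈ E} ∩ F) =
      prob (fun d => ∏ l, q (e l) (d l)) E * prob (fun c => ∏ j, q j (c j)) F := by
  obtain ⟨F', hF'⟩ := dependsOn_iff_exists_comp.1 hF
  have mem_iff (c) : c ∈ F ↔ Set.domRestrict (Set.range e)ᶜ c ∈ {d | F' d} :=
    iff_of_eq (congrFun hF' c)
  have prob_univ : prob (fun d : κ → α => ∏ l, q (e l) (d l)) Set.univ = 1 := by
    simp [prob, ← Fintype.prod_sum fun l a => q (e l) a, hq]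
  have prob_F : prob (fun c => ∏ j, q j (c j)) F =
      prob (fun d => ∏ j : ↥(Set.range e)ᶜ, q j (d j)) {d | F' d} := by
    rw [← one_mul (prob _ {d | F' d}), ← prob_univ, ← prob_prod_eq_mul he]
    congr 1
    ext c
    simp [mem_iff]
  rw [prob_F, ← prob_prod_eq_mul he]
  congr 1
  ext c
  simp [mem_iff]

end Independence

theorem prob_law_errors_mem (A : CollectiveAttack (n + nz + nx))
    (basis : Partition n nz nx → Bits (n + nz + nx)) (P : Partition n nz nx)
    (G : Set (Bits (n + nz + nx))) :
    prob (law A basis) {ω | ω.1 = P ∧ errors ω ∈ G} =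
      (Fintype.card (Partition n nz nx) : ℝ)⁻¹ *
        prob (fun c => ∏ j, A.errProb j (basis P j) (c j)) G := by
  classical
  have errors_add (i c : Bits (n + nz + nx)) : errors (P, i, i + c) = c :=
    funext fun _ => CharTwo.add_cancel_left _ _
  have sum_law (c : Bits (n + nz + nx)) : ∑ i, law A basis (P, i, i + c) =
      (Fintype.card (Partition n nz nx) : ℝ)⁻¹ * ∏ j, A.errProb j (basis P j) (c j) := by
    simp only [law, ← Finset.mul_sum, Pi.add_apply, CollectiveAttack.errProb]
    rw [← Fintype.prod_sum fun j i => A.bobProb j (basis P j) i (i + c j)]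
    simp only [Finset.prod_div_distrib, Finset.prod_const, Finset.card_univ, Fintype.card_fin]
    ring
  calc prob (law A basis) {ω | ω.1 = P ∧ errors ω ∈ G}
      = ∑ i, ∑ y, if errors (P, i, y) ∈ G then law A basis (P, i, y) else 0 := by
        rw [prob, Finset.sum_filter, Fintype.sum_prod_type, Finset.sum_eq_single P]
        · simp [Fintype.sum_prod_type]
        · intro Q _ hQ
          simp [hQ]
        · simp
    _ = ∑ i, ∑ c, if c ∈ G then law A basis (P, i, i + c) else 0 := by
        refine Finset.sum_congr rfl fun i _ => ?_
        rw [← Equiv.sum_comp (Equiv.addLeft i)]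
        simp [errors_add]
    _ = _ := by
        rw [Finset.sum_comm, prob, Finset.sum_filter, Finset.mul_sum]
        simp [← sum_law, Finset.sum_ite_irrel]

theorem condProb_infoErrorEvent (A : CollectiveAttack (n + nz + nx)) {P : Partition n nz nx}
    {cz : Bits nz} {cb : Bits nx}
    (hpos : 0 < prob (law A Partition.conjBasis) (testEvent P cz cb)) (t : ℝ) :
    condProb (law A Partition.conjBasis) (infoErrorEvent t) (testEvent P cz cb) =
      prob (fun c : Bits n => ∏ l, A.errProb (P.infoPos l) 1 (c l)) {c | t ≤ hammingNorm c} := by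
  let test : Set (Bits (n + nz + nx)) := {c | P.testZ c = cz ∧ P.testX c = cb}
  have test_eq : testEvent P cz cb = {ω | ω.1 = P ∧ errors ω ∈ test} := by
    ext ⟨Q, i, y⟩
    exact and_congr_right fun hQ => by subst hQ; rfl
  have info_inter_test_eq : infoErrorEvent t ∩ testEvent P cz cb =
      {ω | ω.1 = P ∧ errors ω ∈ {c | c ∘ P.infoPos ∈ {c : Bits n | t ≤ hammingNorm c}} ∩ test} := by
    rw [test_eq]
    ext ⟨Q, i, y⟩
    exact and_left_comm.trans (and_congr_right fun hQ => by subst hQ; rfl)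
  have dependsOn_test : DependsOn (· ∈ test) (Set.range P.infoPos)ᶜ := fun c c' h => by
    simp only [test, Set.mem_ofPred_eq, P.dependsOn_testZ h, P.dependsOn_testX h]
  have errProb_infoPos (l) : A.errProb (P.infoPos l) (P.conjBasis (P.infoPos l)) =
      A.errProb (P.infoPos l) 1 := by rw [P.conjBasis_infoPos]
  have independent := prob_prod_inter_of_dependsOn (α := ZMod 2)
    (q := fun j => A.errProb j (P.conjBasis j)) P.infoPos_injective
    (fun l => by simp only [errProb_infoPos, A.sum_errProb_one]) {c | t ≤ hammingNorm c}
    dependsOn_test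
  rw [condProb, div_eq_iff hpos.ne', info_inter_test_eq, test_eq, prob_law_errors_mem,
    prob_law_errors_mem, independent, mul_left_comm]
  simp only [errProb_infoPos]

/-! ### The key -/

section Key

variable {r m : ℕ} (PC : Matrix (Fin r) (Fin n) (ZMod 2)) (PK : Matrix (Fin m) (Fin n) (ZMod 2))

theorem minDist_le_hammingNorm_add {PC : Matrix (Fin r) (Fin n) (ZMod 2)}
    {PK : Matrix (Fin m) (Fin n) (ZMod 2)} {i : Fin (r + m)} (hi : r ≤ (i : ℕ)) {c c' : Bits n}
    (h : rows PC PK i + c + c' ∈ Submodule.span (ZMod 2) (rows PC PK '' Set.Iio i)) :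
    minDist PC PK ≤ hammingNorm c + hammingNorm c' := by
  let v := rows PC PK i
  calc minDist PC PK
      ≤ distToSubspace v (Submodule.span (ZMod 2) (rows PC PK '' Set.Iio i)) :=
        Nat.sInf_le ⟨i, hi, rfl⟩
    _ ≤ hammingDist v (v + c + c') := Nat.sInf_le ⟨_, h, rfl⟩
    _ ≤ hammingDist v (v + c) + hammingDist (v + c) (v + c + c') := hammingDist_triangle _ _ _
    _ = hammingNorm c + hammingNorm c' := by
        rw [hammingDist_eq_hammingNorm, hammingDist_eq_hammingNorm, neg_add_cancel_left,
          neg_add_cancel_left]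

theorem codeCoset_rows_univ (ξ : Bits r) (k : Bits m) :
    codeCoset (rows PC PK) (Fin.append ξ k) Finset.univ =
      Finset.univ.filter fun x : Bits n => x ᵥ* PCᵀ = ξ ∧ x ᵥ* PKᵀ = k := by
  ext x
  simp [mem_codeCoset, Fin.forall_fin_add, rows, funext_iff, Matrix.vecMul_transpose,
    Matrix.mulVec, dotProduct_comm x]

theorem codeCoset_rows_syndrome (ξ : Bits r) (k : Bits m) :
    codeCoset (rows PC PK) (Fin.append ξ k) {j | (j : ℕ) < r} = codeCoset PC.row ξ Finset.univ := by
  ext x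
  rw [mem_codeCoset, mem_codeCoset]
  simp [Fin.forall_fin_add, rows, Matrix.row_def]

variable (A : CollectiveAttack (n + nz + nx)) (P : Partition n nz nx)

theorem isHermitian_rhoHat (ξ : Bits r) (k : Bits m) : (rhoHat A P PC PK ξ k).IsHermitian := by
  ext a a'
  simp [rhoHat, Matrix.sum_apply, (isHermitian_rhoInfo A P _ _).apply]

variable {PC PK} (hrows : LinearIndependent (ZMod 2) (rows PC PK))
include hrows

theorem trace_mul_rhoHat (W : Matrix (ProbeIndex A P) (ProbeIndex A P) ℂ) (ξ : Bits r)
    (k : Bits m) :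
    (W * rhoHat A P PC PK ξ k).trace =
      𝔼 x ∈ codeCoset (rows PC PK) (Fin.append ξ k) Finset.univ,
        (W * rhoInfo A P 0 x).trace := by
  have rank_le : r + m ≤ n := by simpa using hrows.fintype_card_le_finrank
  have card_eq : (codeCoset (rows PC PK) (Fin.append ξ k) Finset.univ).card = 2 ^ (n - r - m) := by
    refine Nat.eq_of_mul_eq_mul_right (show 0 < 2 ^ (r + m) by positivity) ?_
    rw [← pow_add, show n - r - m + (r + m) = n by omega]
    simpa using card_codeCoset_mul hrows (Fin.append ξ k) Finset.univ
  rw [Finset.expect_eq_sum_div_card, card_eq, codeCoset_rows_univ, rhoHat, P.info_b,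
    Matrix.mul_smul, Matrix.trace_smul, Matrix.mul_sum, Matrix.trace_sum, smul_eq_mul,
    inv_mul_eq_div]
  norm_cast

theorem norm_trace_mul_rhoHat_sub_le {W : Matrix (ProbeIndex A P) (ProbeIndex A P) ℂ}
    (hW : ‖W‖ ≤ 1) (ξ : Bits r) (k : Bits m) :
    ‖(W * rhoHat A P PC PK ξ k).trace -
        𝔼 x ∈ codeCoset PC.row ξ Finset.univ, (W * rhoInfo A P 0 x).trace‖ ≤
      m * (2 * √(prob (fun c : Bits n => ∏ l, A.errProb (P.infoPos l) 1 (c l))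
        {c | (minDist PC PK : ℝ) / 2 ≤ hammingNorm c})) := by
  classical
  obtain ⟨η, reducedState_eq, horth, norm_sq_η⟩ := exists_infoErrorVec A P
  let T := Matrix.toEuclideanCLM (𝕜 := ℂ)
    (W ⊗ₖ (1 : Matrix (Fin n → ZMod 2 × Fin 2) (Fin n → ZMod 2 × Fin 2) ℂ))
  let H : Finset (Bits n) := {c | (minDist PC PK : ℝ) / 2 ≤ hammingNorm c}
  have norm_T : ‖T‖ ≤ 1 := (norm_kronecker_one_le W).trans hW
  have trace_eq (x) : (W * rhoInfo A P 0 x).trace =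
      ⟪walshSum η Finset.univ x, T (walshSum η Finset.univ x)⟫_ℂ := by
    rw [← reducedState_eq, trace_mul_reducedState]
  have sum_norm_sq : ∑ c, ‖η c‖ ^ 2 = 1 := by
    simp only [norm_sq_η, ← Fintype.prod_sum fun l c => A.errProb (P.infoPos l) 1 c,
      A.sum_errProb_one, Finset.prod_const_one]
  rw [trace_mul_rhoHat A P hrows, ← codeCoset_rows_syndrome PC PK ξ k]
  refine norm_expect_codeCoset_sub_le hrows _ _ fun i hi => ?_
  have far_apart : ∀ c ∉ H, ∀ c' ∉ H, rows PC PK i + c + c' ∉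
      Submodule.span (ZMod 2) (rows PC PK '' Finset.Iio i) := fun c hc c' hc' hmem => by
    have minDist_le : (minDist PC PK : ℝ) ≤ hammingNorm c + hammingNorm c' :=
      mod_cast minDist_le_hammingNorm_add hi (by simpa using hmem)
    simp only [H, Finset.mem_filter, Finset.mem_univ, true_and, not_le] at hc hc'
    linarith
  simp only [trace_eq]
  calc _ ≤ 2 * ‖T‖ * √(∑ c ∈ H, ‖η c‖ ^ 2) :=
        norm_expect_sgn_inner_walshSum_le horth sum_norm_sq T _ _ far_apart
    _ ≤ 2 * 1 * √(∑ c ∈ H, ‖η c‖ ^ 2) := by gcongr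
    _ = _ := by simp only [mul_one, norm_sq_η, prob, H, Set.mem_ofPred_eq]

end Key

end BB84InfoZ

open BB84InfoZ in
theorem mainTheorem4 {n nz nx r m : ℕ}
    (PC : Matrix (Fin r) (Fin n) (ZMod 2)) (PK : Matrix (Fin m) (Fin n) (ZMod 2))
    (hrows : LinearIndependent (ZMod 2) (BB84InfoZ.rows PC PK))
    (A : BB84InfoZ.CollectiveAttack (n + nz + nx))
    (P : BB84InfoZ.Partition n nz nx)
    (cz : BB84InfoZ.Bits nz) (cb : BB84InfoZ.Bits nx)
    (hpos : 0 < BB84InfoZ.prob (BB84InfoZ.law A BB84InfoZ.Partition.conjBasis)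
      (BB84InfoZ.testEvent P cz cb))
    (ξ : BB84InfoZ.Bits r) (k k' : BB84InfoZ.Bits m) :
    (1 / 2 : ℝ) * BB84InfoZ.trAbs
        (BB84InfoZ.rhoHat A P PC PK ξ k - BB84InfoZ.rhoHat A P PC PK ξ k') ≤
      2 * (m : ℝ) * Real.sqrt
        (BB84InfoZ.condProb (BB84InfoZ.law A BB84InfoZ.Partition.conjBasis)
          (BB84InfoZ.infoErrorEvent ((BB84InfoZ.minDist PC PK : ℝ) / 2))
          (BB84InfoZ.testEvent P cz cb)) := by
  obtain ⟨W, hW, trAbs_eq⟩ := exists_norm_le_one_trAbs_eq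
    ((isHermitian_rhoHat PC PK A P ξ k).sub (isHermitian_rhoHat PC PK A P ξ k'))
  have close_k := norm_trace_mul_rhoHat_sub_le A P hrows hW ξ k
  have close_k' := norm_trace_mul_rhoHat_sub_le A P hrows hW ξ k'
  rw [← dist_eq_norm, ← condProb_infoErrorEvent A hpos] at close_k close_k'
  have trAbs_le : trAbs (rhoHat A P PC PK ξ k - rhoHat A P PC PK ξ k') ≤
      dist (W * rhoHat A P PC PK ξ k).trace (W * rhoHat A P PC PK ξ k').trace := by
    rw [trAbs_eq, Matrix.mul_sub, Matrix.trace_sub, dist_eq_norm]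
    exact Complex.re_le_norm _
  have := trAbs_le.trans ((dist_triangle_right _ _ _).trans (add_le_add close_k close_k'))
  linarith
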